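/- Let $(X,\mathcal S)$ be a measurable space, let $\mathcal C\subseteq\mathcal S$ be a concept class with VC-dimension at most $d$, where $d\ge 1$ is an integer, and let $P$ be any probability measure on $X$. Let $0\le\alpha<1/2$, and let $P_N$ be the product measure on $X\times\{0,1\}$ with $P_N(S\times\{0\})=(1-\alpha)P(S)$ and $P_N(S\times\{1\})=\alpha P(S)$ for $S\in\mathcal S$. Draw independent samples $(c_1,\omega_1),\dots,(c_m,\omega_m)$ from $P_N$. For $T,F\in\mathcal C$ let $y_i=|I_T(c_i)-\omega_i|$ be the noisy labels, and put $$\hat J_m(T,F)=\frac1m\sum_{i=1}^m|y_i-I_F(c_i)|,\qquad J(T,F)=\int_{X\times\{0,1\}}\bigl|\,|I_T(x)-\omega|-I_F(x)\bigr|\,P_N(d(x,\omega)).$$ Then for every $\epsilon>0$ and every integer $m\ge 2d$, $$\sup_{T,F\in\mathcal C}\Pr\bigl\{|J(T,F)-\hat J_m(T,F)|>\epsilon\bigr\}\le 4\Bigl(\frac{0.2\,e\,m}{d}\Bigr)^{10d}\exp(-m\epsilon^2/8).$$ Moreover, suppose that the class satisfies the usual measurability condition: for two independent samples of size $m$ with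 empirical risks $\hat J_m$ and $\hat J_m'$, the function $\sup_{T,F\in\mathcal C}|\hat J_m(T,F)-\hat J_m'(T,F)|$ is measurable up to null sets. Then the convergence is uniform in the same sense over the class, that is, the same bound holds for the (outer) probability $$\Pr\bigl\{\exists\,T,F\in\mathcal C:\ |J(T,F)-\hat J_m(T,F)|>\epsilon\bigr\}.$$ -/

import Mathlib

noncomputable section

open MeasureTheory

namespace NoisyPAC

variable {X : Type*}

/-- The finite set `S` is shattered by `C`: every `B ⊆ S` is `S ∩ A` for some `A ∈ C`. -/
def Shatters (C : Set (Set X)) (S : Finset X) : Prop :=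
  ∀ B : Set X, B ⊆ (S : Set X) → ∃ A ∈ C, (S : Set X) ∩ A = B

/-- The Vapnik-Chervonenkis dimension, with values in `ℕ∞`: the supremum of the cardinalities of
the finite sets shattered by `C`. -/
def vcDim (C : Set (Set X)) : ℕ∞ :=
  ⨆ (S : Finset X) (_ : Shatters C S), (S.card : ℕ∞)

/-- The indicator function `I_A : X → {0, 1} ⊆ ℝ`. -/
def ind (A : Set X) : X → ℝ := A.indicator (fun _ => 1)

/-- The law on `{0, 1}` of the flip variable: `1` (that is, `true`) with probability `α`. -/
def flipLaw (α : ℝ) : Measure Bool :=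
  ENNReal.ofReal (1 - α) • Measure.dirac false + ENNReal.ofReal α • Measure.dirac true

/-- The measure `P_N = P ⊗ flipLaw α` on `X_N = X × {0, 1}`. -/
def noisyMeasure [MeasurableSpace X] (P : Measure X) (α : ℝ) : Measure (X × Bool) :=
  P.prod (flipLaw α)

/-- The law of `m` independent samples `(c_i, ω_i)`, each distributed according to `P_N`. -/
def sampleLaw [MeasurableSpace X] (P : Measure X) (α : ℝ) (m : ℕ) :
    Measure (Fin m → X × Bool) :=
  Measure.pi (fun _ => noisyMeasure P α)

/-- The noisy label `y = |I_T(c) - ω|` of the sample `(c, ω)` for the target concept `T`. -/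
def label (T : Set X) (z : X × Bool) : ℝ :=
  |ind T z.1 - (if z.2 then 1 else 0)|

/-- The loss `|y - I_F(c)|` of the hypothesis `F` on the noisy sample `(c, ω)`. -/
def loss (T F : Set X) (z : X × Bool) : ℝ :=
  |label T z - ind F z.1|

/-- The error `J(T, F) = E[|y - I_F(x)|, P_N]`. -/
def risk [MeasurableSpace X] (P : Measure X) (α : ℝ) (T F : Set X) : ℝ :=
  ∫ z, loss T F z ∂(noisyMeasure P α)

/-- The empirical risk `Ĵ_m(T, F) = (1 / m) ∑ |y_i - I_F(c_i)|`. -/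
def empRisk {m : ℕ} (T F : Set X) (z : Fin m → X × Bool) : ℝ :=
  (1 / (m : ℝ)) * ∑ i, loss T F (z i)

/-- The usual measurability condition on the class in uniform laws of large numbers: the largest
difference, over `T, F ∈ C`, between the empirical risks of two independent `m`-samples is a
measurable function of the two samples, up to null sets. (It holds automatically for countable
classes.) -/
def WellBehaved [MeasurableSpace X] (C : Set (Set X)) (P : Measure X) (α : ℝ) (m : ℕ) : Prop :=
  ∀ η : ℝ, NullMeasurableSet
    {z : (Fin m → X × Bool) × (Fin m → X × Bool) |
      ∃ T ∈ C, ∃ F ∈ C, η < |empRisk T F z.1 - empRisk T F z.2|}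
    ((sampleLaw P α m).prod (sampleLaw P α m))

end NoisyPAC

end

/-! For a fixed pair `T, F` the bound is Hoeffding's inequality, with room to spare. The uniform
bound is the Vapnik-Chervonenkis argument. A ghost sample replaces the true risk by a second
empirical risk (`sampleLaw_exists_le_two_mul`, at the cost of a factor 2 and of `ε / 2` for `ε`).
Swapping matching points of the two samples preserves their law, so it suffices to count bad swaps
for fixed data (`measure_le_of_card_swapSamples_le`). On the `2 m` fixed points only the traces of
`T` and `F` matter; by Sauer-Shelah there are at most `(2 e m / d) ^ (2 d)` pairs of them, and each
pair obeys Hoeffding for random signs (`card_swapSamples_deviation_le`). This gives `4 (2 e m / d) ^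
(2 d) exp (-m ε² / 8)`, which is below the claimed bound once `m ≥ 4 d`. For `m < 4 d` and `ε ≤ 1`
the claimed bound is at least 1; for `ε > 1` the event is empty. -/

namespace NoisyPAC

open MeasureTheory

/-! ### Hoeffding's inequality for random signs. -/

section SignSums

/-- The sign attached to a Boolean swap variable: `-1` for `true`, `1` for `false`. -/
noncomputable def sgn (b : Bool) : ℝ := if b then -1 else 1

/-- The sum over sign vectors factors into terms `2 cosh (t c_i)`, and `cosh u ≤ exp (u² / 2)`. -/
theorem sum_exp_sgn_le {m : ℕ} (c : Fin m → ℝ) (hc : ∀ i, |c i| ≤ 1) (t : ℝ) :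
    ∑ σ : Fin m → Bool, Real.exp (t * ∑ i, sgn (σ i) * c i) ≤
      2 ^ m * Real.exp (m * t ^ 2 / 2) := by
  have key : ∑ σ : Fin m → Bool, Real.exp (t * ∑ i, sgn (σ i) * c i) =
      ∏ i, ∑ b : Bool, Real.exp (t * (sgn b * c i)) := by
    rw [Finset.prod_univ_sum, Fintype.piFinset_univ]
    refine Finset.sum_congr rfl fun σ _ => ?_
    rw [Finset.mul_sum, Real.exp_sum]
  have hfac : ∀ i, ∑ b : Bool, Real.exp (t * (sgn b * c i)) ≤ 2 * Real.exp (t ^ 2 / 2) := by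
    intro i
    have h1 := Real.cosh_le_exp_half_sq (t * c i)
    have h2 : Real.exp ((t * c i) ^ 2 / 2) ≤ Real.exp (t ^ 2 / 2) := by
      apply Real.exp_le_exp.2
      have : c i ^ 2 ≤ 1 := (sq_le_one_iff_abs_le_one _).2 (hc i)
      nlinarith [sq_nonneg t]
    rw [Real.cosh_eq] at h1
    simp only [Fintype.sum_bool, sgn, if_true, Bool.false_eq_true, if_false, one_mul, neg_mul,
      mul_neg]
    linarith
  rw [key]
  calc ∏ i, ∑ b : Bool, Real.exp (t * (sgn b * c i))
      ≤ ∏ _i : Fin m, 2 * Real.exp (t ^ 2 / 2) :=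
        Finset.prod_le_prod (fun i _ => Finset.sum_nonneg fun b _ => (Real.exp_pos _).le)
          fun i _ => hfac i
    _ = 2 ^ m * Real.exp (m * t ^ 2 / 2) := by
        rw [Finset.prod_const, Finset.card_univ, Fintype.card_fin, mul_pow, ← Real.exp_nat_mul]
        congr 2
        ring

/-- Chernoff's method at `t = η`, which minimises `m t² / 2 - m t η`. -/
theorem card_mul_le_of_lt_sum_sgn {m : ℕ} (c : Fin m → ℝ) (hc : ∀ i, |c i| ≤ 1)
    {η : ℝ} (hη : 0 ≤ η) (S : Finset (Fin m → Bool))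
    (hS : ∀ σ ∈ S, m * η < ∑ i, sgn (σ i) * c i) :
    (S.card : ℝ) * Real.exp (m * η ^ 2) ≤ 2 ^ m * Real.exp (m * η ^ 2 / 2) := by
  refine le_trans ?_ (sum_exp_sgn_le c hc η)
  rw [← nsmul_eq_mul]
  refine (Finset.card_nsmul_le_sum S
    (fun σ : Fin m → Bool => Real.exp (η * ∑ i, sgn (σ i) * c i)) _ fun σ hσ => ?_).trans
    (Finset.sum_le_univ_sum_of_nonneg fun _ => (Real.exp_pos _).le)
  apply Real.exp_le_exp.2
  calc (m : ℝ) * η ^ 2 = η * (m * η) := by ring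
    _ ≤ _ := mul_le_mul_of_nonneg_left (hS σ hσ).le hη

theorem card_le_of_lt_sum_sgn {m : ℕ} (c : Fin m → ℝ) (hc : ∀ i, |c i| ≤ 1)
    {η : ℝ} (hη : 0 ≤ η) (S : Finset (Fin m → Bool))
    (hS : ∀ σ ∈ S, m * η < ∑ i, sgn (σ i) * c i) :
    (S.card : ℝ) ≤ 2 ^ m * Real.exp (-(m * η ^ 2) / 2) := by
  have h1 := card_mul_le_of_lt_sum_sgn c hc hη S hS
  have h2 : Real.exp (m * η ^ 2 / 2) = Real.exp (-(m * η ^ 2) / 2) * Real.exp (m * η ^ 2) := by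
    rw [← Real.exp_add]
    congr 1
    ring
  rw [h2, ← mul_assoc] at h1
  exact le_of_mul_le_mul_right h1 (Real.exp_pos _)

open Classical in
/-- Hoeffding's inequality for sums of random signs, in counting form. -/
theorem card_lt_abs_sum_sgn_le {m : ℕ} (c : Fin m → ℝ) (hc : ∀ i, |c i| ≤ 1)
    {η : ℝ} (hη : 0 ≤ η) :
    ((Finset.univ.filter fun σ : Fin m → Bool => m * η < |∑ i, sgn (σ i) * c i|).card : ℝ) ≤
      2 ^ m * (2 * Real.exp (-(m * η ^ 2) / 2)) := by
  have h1 := card_le_of_lt_sum_sgn c hc hη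
    (Finset.univ.filter fun σ : Fin m → Bool => m * η < ∑ i, sgn (σ i) * c i)
    fun σ hσ => (Finset.mem_filter.1 hσ).2
  have h2 := card_le_of_lt_sum_sgn (fun i => -c i) (fun i => by rw [abs_neg]; exact hc i) hη
    (Finset.univ.filter fun σ : Fin m → Bool => m * η < ∑ i, sgn (σ i) * -c i)
    fun σ hσ => (Finset.mem_filter.1 hσ).2
  have hsub : (Finset.univ.filter fun σ : Fin m → Bool => m * η < |∑ i, sgn (σ i) * c i|) ⊆
      (Finset.univ.filter fun σ : Fin m → Bool => m * η < ∑ i, sgn (σ i) * c i) ∪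
      (Finset.univ.filter fun σ : Fin m → Bool => m * η < ∑ i, sgn (σ i) * -c i) := by
    intro σ hσ
    simp only [Finset.mem_filter, Finset.mem_univ, true_and, Finset.mem_union, mul_neg,
      Finset.sum_neg_distrib] at hσ ⊢
    exact lt_abs.1 hσ
  have h3 : ((Finset.univ.filter fun σ : Fin m → Bool =>
      m * η < |∑ i, sgn (σ i) * c i|).card : ℝ) ≤ _ :=
    Nat.cast_le.2 ((Finset.card_le_card hsub).trans (Finset.card_union_le _ _))
  push_cast at h3
  linarith

end SignSums

/-! ### Sauer-Shelah for traces on a finite family of points. -/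

section Traces

/-- With `r = d / n ≤ 1`, `r ^ d ≤ r ^ k` for `k ≤ d`, so `r ^ d` times the sum is at most `(1 + r)
^ n ≤ e ^ d`. -/
theorem sum_choose_le {n d : ℕ} (hd : 1 ≤ d) (hdn : d ≤ n) :
    ((∑ k ∈ Finset.Iic d, n.choose k : ℕ) : ℝ) ≤ (Real.exp 1 * n / d) ^ d := by
  have hd0 : (0 : ℝ) < d := by exact_mod_cast hd
  have hn0 : (0 : ℝ) < n := by exact_mod_cast (lt_of_lt_of_le hd hdn)
  set r : ℝ := d / n with hr
  have hr0 : 0 < r := div_pos hd0 hn0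
  have hr1 : r ≤ 1 := (div_le_one hn0).2 (by exact_mod_cast hdn)
  have h1 : ((∑ k ∈ Finset.Iic d, n.choose k : ℕ) : ℝ) * r ^ d ≤ (1 + r) ^ n := by
    push_cast
    rw [add_comm, add_pow, Finset.sum_mul]
    calc ∑ k ∈ Finset.Iic d, (n.choose k : ℝ) * r ^ d
        ≤ ∑ k ∈ Finset.Iic d, r ^ k * 1 ^ (n - k) * (n.choose k : ℝ) := by
          refine Finset.sum_le_sum fun k hk => ?_
          rw [one_pow, mul_one, mul_comm]
          exact mul_le_mul_of_nonneg_right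
            (pow_le_pow_of_le_one hr0.le hr1 (Finset.mem_Iic.1 hk)) (Nat.cast_nonneg _)
      _ ≤ ∑ k ∈ Finset.range (n + 1), r ^ k * 1 ^ (n - k) * (n.choose k : ℝ) := by
          refine Finset.sum_le_sum_of_subset_of_nonneg ?_ fun k _ _ => by positivity
          intro k hk
          have := Finset.mem_Iic.1 hk
          exact Finset.mem_range.2 (by omega)
  have h2 : (1 + r) ^ n ≤ Real.exp 1 ^ d := by
    calc (1 + r) ^ n ≤ Real.exp r ^ n :=
          pow_le_pow_left₀ (by positivity) (by linarith [Real.add_one_le_exp r]) n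
      _ = Real.exp 1 ^ d := by
          rw [← Real.exp_nat_mul, ← Real.exp_nat_mul, hr]
          congr 1
          field_simp
  have h3 : (Real.exp 1 * n / d) ^ d * r ^ d = Real.exp 1 ^ d := by
    rw [← mul_pow, hr]
    congr 1
    field_simp
  rw [← h3] at h2
  exact le_of_mul_le_mul_right (h1.trans h2) (by positivity)

variable {X ι : Type*} [Fintype ι]

open Classical in
/-- The traces of the class `C` on a finite family of points. -/
noncomputable def traces (C : Set (Set X)) (p : ι → X) : Finset (Finset ι) :=
  Finset.univ.filter fun s => ∃ A ∈ C, ∀ i, i ∈ s ↔ p i ∈ A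

theorem mem_traces {C : Set (Set X)} {p : ι → X} {s : Finset ι} :
    s ∈ traces C p ↔ ∃ A ∈ C, ∀ i, i ∈ s ↔ p i ∈ A := by
  simp [traces]

open Classical in
theorem card_le_of_traces_shatters {C : Set (Set X)} {d : ℕ} (hvc : vcDim C ≤ (d : ℕ∞))
    {p : ι → X} {s : Finset ι} (hs : (traces C p).Shatters s) : s.card ≤ d := by
  -- Points may repeat in the family, but no trace separates two indices of the same point, so a
  -- shattered index set has distinct points.
  have hinj : Set.InjOn p s := by
    intro i hi j hj hij
    obtain ⟨u, hu, hsu⟩ := hs (Finset.singleton_subset_iff.2 hi)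
    obtain ⟨A, -, hA⟩ := mem_traces.1 hu
    have hiu : i ∈ s ∩ u := hsu ▸ Finset.mem_singleton_self i
    have hju : j ∈ s ∩ u := Finset.mem_inter.2
      ⟨hj, (hA j).2 (hij ▸ (hA i).1 (Finset.mem_inter.1 hiu).2)⟩
    rw [hsu] at hju
    exact (Finset.mem_singleton.1 hju).symm
  have hsh : Shatters C (s.image p) := by
    intro B hB
    obtain ⟨u, hu, hsu⟩ := hs (Finset.filter_subset (fun i => p i ∈ B) s)
    obtain ⟨A, hAC, hA⟩ := mem_traces.1 hu
    refine ⟨A, hAC, ?_⟩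
    have hiff : ∀ i ∈ s, (p i ∈ A ↔ p i ∈ B) := by
      intro i hi
      have := Finset.ext_iff.1 hsu i
      simp only [Finset.mem_inter, Finset.mem_filter, hi, true_and] at this
      rw [← hA i, this]
    ext x
    constructor
    · rintro ⟨hx, hxA⟩
      obtain ⟨i, hi, rfl⟩ := Finset.mem_image.1 (Finset.mem_coe.1 hx)
      exact (hiff i hi).1 hxA
    · intro hx
      refine ⟨hB hx, ?_⟩
      obtain ⟨i, hi, rfl⟩ := Finset.mem_image.1 (Finset.mem_coe.1 (hB hx))
      exact (hiff i hi).2 hx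
  have h := (le_iSup₂ (f := fun (S : Finset X) (_ : Shatters C S) => (S.card : ℕ∞))
    _ hsh).trans hvc
  rw [Finset.card_image_of_injOn hinj] at h
  exact_mod_cast h

/-- A set family has at most as many members as it shatters sets, and here every shattered set has
at most `d` elements. -/
theorem card_traces_le {C : Set (Set X)} {d : ℕ} (hd : 1 ≤ d) (hvc : vcDim C ≤ (d : ℕ∞))
    (hdn : d ≤ Fintype.card ι) (p : ι → X) :
    ((traces C p).card : ℝ) ≤ (Real.exp 1 * Fintype.card ι / d) ^ d := by
  classical
  refine le_trans (Nat.cast_le.2 ?_) (sum_choose_le hd hdn)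
  refine (Finset.card_le_card_shatterer _).trans (Finset.card_shatterer_le_sum_vcDim.trans ?_)
  refine Finset.sum_le_sum_of_subset (Finset.Iic_subset_Iic.2 ?_)
  exact Finset.sup_le fun s hs => card_le_of_traces_shatters hvc (Finset.mem_shatterer.1 hs)

end Traces

/-! ### Bounds and measurability of the loss and the risks. -/

section Loss

variable {X : Type*}

theorem loss_mem_Icc (T F : Set X) (z : X × Bool) : loss T F z ∈ Set.Icc (0 : ℝ) 1 := by
  classical
  unfold loss label ind
  rw [Set.indicator_apply, Set.indicator_apply]
  constructor <;> split_ifs <;> norm_num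

theorem loss_congr {T F T' F' : Set X} {z : X × Bool} (hT : z.1 ∈ T ↔ z.1 ∈ T')
    (hF : z.1 ∈ F ↔ z.1 ∈ F') : loss T F z = loss T' F' z := by
  classical
  unfold loss label ind
  simp only [Set.indicator_apply, hT, hF]

theorem abs_loss_sub_loss_le (T F : Set X) (z z' : X × Bool) :
    |loss T F z - loss T F z'| ≤ 1 := by
  have h := loss_mem_Icc T F z
  have h' := loss_mem_Icc T F z'
  rw [abs_le]
  constructor <;> linarith [h.1, h.2, h'.1, h'.2]

theorem empRisk_mem_Icc {m : ℕ} (T F : Set X) (z : Fin m → X × Bool) :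
    empRisk T F z ∈ Set.Icc (0 : ℝ) 1 := by
  have h0 : 0 ≤ ∑ i, loss T F (z i) := Finset.sum_nonneg fun i _ => (loss_mem_Icc T F _).1
  have h1 : ∑ i, loss T F (z i) ≤ m := by
    simpa using Finset.sum_le_sum fun i (_ : i ∈ Finset.univ) => (loss_mem_Icc T F (z i)).2
  unfold empRisk
  refine ⟨by positivity, ?_⟩
  rw [one_div, ← div_eq_inv_mul]
  exact div_le_one_of_le₀ h1 (Nat.cast_nonneg _)

variable [MeasurableSpace X]

theorem measurable_loss {T F : Set X} (hT : MeasurableSet T) (hF : MeasurableSet F) :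
    Measurable (loss T F) := by
  have hi : ∀ {A : Set X}, MeasurableSet A → Measurable fun z : X × Bool => ind A z.1 :=
    fun hA => (measurable_const.indicator hA).comp measurable_fst
  have hb : Measurable fun z : X × Bool => if z.2 then (1 : ℝ) else 0 :=
    (measurable_of_finite fun b : Bool => if b then (1 : ℝ) else 0).comp measurable_snd
  have hl : Measurable (label T) := ((hi hT).sub hb).abs
  exact (hl.sub (hi hF)).abs

theorem isProbabilityMeasure_flipLaw {α : ℝ} (h0 : 0 ≤ α) (h1 : α ≤ 1) :
    IsProbabilityMeasure (flipLaw α) := by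
  refine ⟨?_⟩
  simp only [flipLaw, Measure.coe_add, Measure.coe_smul, Pi.add_apply, Pi.smul_apply,
    measure_univ, smul_eq_mul, mul_one]
  rw [← ENNReal.ofReal_add (by linarith) h0]
  simp

theorem isProbabilityMeasure_noisyMeasure (P : Measure X) [IsProbabilityMeasure P] {α : ℝ}
    (h0 : 0 ≤ α) (h1 : α ≤ 1) : IsProbabilityMeasure (noisyMeasure P α) := by
  have := isProbabilityMeasure_flipLaw h0 h1
  unfold noisyMeasure
  infer_instance

theorem risk_mem_Icc (P : Measure X) {α : ℝ} [IsProbabilityMeasure (noisyMeasure P α)]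
    {T F : Set X} (hT : MeasurableSet T) (hF : MeasurableSet F) :
    risk P α T F ∈ Set.Icc (0 : ℝ) 1 := by
  refine ⟨integral_nonneg fun z => (loss_mem_Icc T F z).1, ?_⟩
  have hint : Integrable (loss T F) (noisyMeasure P α) :=
    Integrable.of_mem_Icc 0 1 (measurable_loss hT hF).aemeasurable
      (Filter.Eventually.of_forall (loss_mem_Icc T F))
  simpa [risk] using integral_mono hint (integrable_const (1 : ℝ)) fun z => (loss_mem_Icc T F z).2

end Loss

/-! ### Hoeffding's inequality for independent samples. -/

section Hoeffding

open ProbabilityTheory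

variable {Z : Type*} [MeasurableSpace Z]

/-- A range of length 1 gives sub-Gaussian parameter `1 / 4`. The free endpoint `a` covers both the
loss and its negative. -/
theorem measureReal_pi_ge_sum_le (μ : Measure Z) [IsProbabilityMeasure μ] {m : ℕ} (hm : 0 < m)
    {f : Z → ℝ} {a : ℝ} (hf : Measurable f) (hb : ∀ z, f z ∈ Set.Icc a (a + 1))
    {η : ℝ} (hη : 0 ≤ η) :
    (Measure.pi fun _ : Fin m => μ).real {z | m * η ≤ ∑ i, (f (z i) - ∫ x, f x ∂μ)} ≤
      Real.exp (-2 * m * η ^ 2) := by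
  have hind : iIndepFun (fun (i : Fin m) (z : Fin m → Z) => f (z i) - ∫ x, f x ∂μ)
      (Measure.pi fun _ => μ) :=
    iIndepFun_pi (X := fun _ x => f x - ∫ x, f x ∂μ)
      fun _ => (hf.sub_const _).aemeasurable
  have hsub : ∀ i ∈ (Finset.univ : Finset (Fin m)),
      HasSubgaussianMGF (fun z : Fin m → Z => f (z i) - ∫ x, f x ∂μ)
        ((‖(a + 1) - a‖₊ / 2) ^ 2) (Measure.pi fun _ => μ) := by
    intro i _
    have hmp := measurePreserving_eval (fun _ : Fin m => μ) i
    have hint : ∫ z : Fin m → Z, f (z i) ∂(Measure.pi fun _ => μ) = ∫ x, f x ∂μ := by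
      conv_rhs => rw [← hmp.map_eq]
      rw [integral_map hmp.measurable.aemeasurable hf.aestronglyMeasurable]
    have h := hasSubgaussianMGF_of_mem_Icc (μ := Measure.pi fun _ : Fin m => μ)
      (X := fun z : Fin m → Z => f (z i)) (a := a) (b := a + 1)
      (hf.comp (measurable_pi_apply i)).aemeasurable
      (Filter.Eventually.of_forall fun z => hb (z i))
    rwa [hint] at h
  have hm' : (0 : ℝ) < m := by exact_mod_cast hm
  refine (HasSubgaussianMGF.measure_sum_ge_le_of_iIndepFun hind hsub
    (ε := m * η) (by positivity)).trans_eq ?_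
  congr 1
  simp only [add_sub_cancel_left, nnnorm_one, Finset.sum_const, Finset.card_univ,
    Fintype.card_fin, nsmul_eq_mul]
  push_cast
  field_simp

end Hoeffding

section Deviation

variable {X : Type*} [MeasurableSpace X]

/-- Hoeffding's inequality for the empirical risk of a fixed pair of concepts. -/
theorem sampleLaw_deviation_le (P : Measure X) {α : ℝ} [IsProbabilityMeasure (noisyMeasure P α)]
    {m : ℕ} (hm : 0 < m) {T F : Set X} (hT : MeasurableSet T) (hF : MeasurableSet F)
    {η : ℝ} (hη : 0 ≤ η) :
    sampleLaw P α m {z | η < |risk P α T F - empRisk T F z|} ≤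
      ENNReal.ofReal (2 * Real.exp (-2 * m * η ^ 2)) := by
  have hm' : (0 : ℝ) < m := by exact_mod_cast hm
  have h1 := measureReal_pi_ge_sum_le (noisyMeasure P α) hm (a := 0) (measurable_loss hT hF)
    (fun z => by simpa using loss_mem_Icc T F z) hη
  have h2 := measureReal_pi_ge_sum_le (noisyMeasure P α) hm (a := -1)
    (f := fun z => -loss T F z) (measurable_loss hT hF).neg
    (fun z => by
      have := loss_mem_Icc T F z
      exact ⟨by linarith [this.2], by linarith [this.1]⟩) hη
  have : IsProbabilityMeasure (sampleLaw P α m) := by unfold sampleLaw; infer_instance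
  rw [← ofReal_measureReal]
  refine ENNReal.ofReal_le_ofReal ?_
  have hsub : {z : Fin m → X × Bool | η < |risk P α T F - empRisk T F z|} ⊆
      {z | m * η ≤ ∑ i, (loss T F (z i) - ∫ x, loss T F x ∂(noisyMeasure P α))} ∪
      {z | m * η ≤ ∑ i, (-loss T F (z i) - ∫ x, -loss T F x ∂(noisyMeasure P α))} := by
    intro z hz
    have hsum : ∑ i, loss T F (z i) = m * empRisk T F z := by
      unfold empRisk
      field_simp
    simp only [Set.mem_union, Set.mem_ofPred_eq, Finset.sum_sub_distrib, Finset.sum_neg_distrib,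
      integral_neg, Finset.sum_const, Finset.card_univ, Fintype.card_fin, nsmul_eq_mul, hsum]
    change m * η ≤ m * empRisk T F z - m * risk P α T F ∨
      m * η ≤ -(m * empRisk T F z) - -(m * risk P α T F)
    have hz' : η < |risk P α T F - empRisk T F z| := hz
    rcases lt_abs.1 hz' with h | h
    · right
      nlinarith
    · left
      nlinarith
  refine (measureReal_mono hsub).trans ((measureReal_union_le _ _).trans ?_)
  unfold sampleLaw
  linarith

end Deviation

/-! ### Invariance of the double sample under swaps. -/

section Swap

variable {Z : Type*} {m : ℕ}

/-- Exchange the `i`-th points of the two samples for those `i` with `σ i = true`. -/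
def swapSamples (σ : Fin m → Bool) (p : (Fin m → Z) × (Fin m → Z)) :
    (Fin m → Z) × (Fin m → Z) :=
  (fun i => if σ i then p.2 i else p.1 i, fun i => if σ i then p.1 i else p.2 i)

variable [MeasurableSpace Z]

/-- Regarded as a sequence of pairs, the double sample is swapped coordinate by coordinate, and each
swap preserves `μ.prod μ`. -/
theorem measurePreserving_swapSamples (μ : Measure Z) [SigmaFinite μ] (σ : Fin m → Bool) :
    MeasurePreserving (swapSamples (Z := Z) σ)
      ((Measure.pi fun _ => μ).prod (Measure.pi fun _ => μ))
      ((Measure.pi fun _ => μ).prod (Measure.pi fun _ => μ)) := by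
  have he := measurePreserving_arrowProdEquivProdArrow Z Z (Fin m) (fun _ => μ) (fun _ => μ)
  have hs : MeasurePreserving
      (fun (a : Fin m → Z × Z) i => (if σ i then Prod.swap else id : Z × Z → Z × Z) (a i))
      (Measure.pi fun _ => μ.prod μ) (Measure.pi fun _ => μ.prod μ) := by
    refine measurePreserving_pi (fun _ : Fin m => μ.prod μ) (fun _ => μ.prod μ)
      (f := fun i => if σ i then Prod.swap else id) fun i => ?_
    split_ifs
    · exact Measure.measurePreserving_swap
    · exact MeasurePreserving.id _
  convert he.comp (hs.comp (he.symm _)) using 1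
  funext p
  ext i
  · simp only [swapSamples, Function.comp, MeasurableEquiv.arrowProdEquivProdArrow,
      Equiv.arrowProdEquivProdArrow]
    change _ = ((if σ i then Prod.swap else id : Z × Z → Z × Z) (p.1 i, p.2 i)).1
    split_ifs <;> rfl
  · simp only [swapSamples, Function.comp, MeasurableEquiv.arrowProdEquivProdArrow,
      Equiv.arrowProdEquivProdArrow]
    change _ = ((if σ i then Prod.swap else id : Z × Z → Z × Z) (p.1 i, p.2 i)).2
    split_ifs <;> rfl

open Classical in
/-- An event on two samples has measure at most `K` if for every pair of samples at most a
fraction `K` of all coordinatewise swaps lies in the event. -/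
theorem measure_le_of_card_swapSamples_le (μ : Measure Z) [IsProbabilityMeasure μ]
    {B : Set ((Fin m → Z) × (Fin m → Z))}
    (hB : NullMeasurableSet B ((Measure.pi fun _ => μ).prod (Measure.pi fun _ => μ)))
    {K : ℝ} (hK : ∀ p, ((Finset.univ.filter fun σ : Fin m → Bool =>
      swapSamples σ p ∈ B).card : ℝ) ≤ 2 ^ m * K) :
    ((Measure.pi fun _ => μ).prod (Measure.pi fun _ => μ)) B ≤ ENNReal.ofReal K := by
  set ν := (Measure.pi fun _ : Fin m => μ).prod (Measure.pi fun _ : Fin m => μ)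
  -- A measurable subset of full measure in `B` inherits the counting bound.
  obtain ⟨B', hB'B, hB'm, hB'⟩ := hB.exists_measurable_subset_ae_eq
  rw [← measure_congr hB']
  have hmeas : ∀ σ : Fin m → Bool, MeasurableSet (swapSamples (Z := Z) σ ⁻¹' B') :=
    fun σ => (measurePreserving_swapSamples μ σ).measurable hB'm
  have hsum : (2 : ENNReal) ^ m * ν B' =
      ∫⁻ p, ∑ σ : Fin m → Bool, (swapSamples σ ⁻¹' B').indicator 1 p ∂ν := by
    rw [lintegral_finsetSum _ fun σ _ => measurable_one.indicator (hmeas σ)]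
    have : ∀ σ : Fin m → Bool, ∫⁻ p, (swapSamples σ ⁻¹' B').indicator 1 p ∂ν = ν B' := by
      intro σ
      rw [lintegral_indicator_one (hmeas σ)]
      exact (measurePreserving_swapSamples μ σ).measure_preimage hB'm.nullMeasurableSet
    simp [this]
  have hpt : ∀ p, ∑ σ : Fin m → Bool, (swapSamples σ ⁻¹' B').indicator (1 : (Fin m → Z) × (Fin m → Z) → ENNReal) p ≤
      ENNReal.ofReal (2 ^ m * K) := by
    intro p
    have hcard : ((Finset.univ.filter fun σ : Fin m → Bool => swapSamples σ p ∈ B').card : ℝ) ≤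
        2 ^ m * K := by
      refine le_trans (Nat.cast_le.2 (Finset.card_le_card fun σ hσ => ?_)) (hK p)
      simp only [Finset.mem_filter, Finset.mem_univ, true_and] at hσ ⊢
      exact hB'B hσ
    refine le_trans (le_of_eq ?_) (ENNReal.ofReal_le_ofReal hcard)
    simp [Set.indicator_apply]
  have hle : (2 : ENNReal) ^ m * ν B' ≤ 2 ^ m * ENNReal.ofReal K := by
    rw [hsum]
    refine (lintegral_mono hpt).trans ?_
    rw [lintegral_const, measure_univ, mul_one, ENNReal.ofReal_mul (by positivity),
      ENNReal.ofReal_pow (by norm_num), ENNReal.ofReal_ofNat]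
  exact (ENNReal.mul_le_mul_iff_right (by positivity) (by finiteness)).1 hle

end Swap

/-! ### Ghost sample and union bound over traces. -/

section Symmetrization

variable {X : Type*} {m : ℕ}

theorem empRisk_swapSamples_sub (T F : Set X) (σ : Fin m → Bool)
    (p : (Fin m → X × Bool) × (Fin m → X × Bool)) :
    empRisk T F (swapSamples σ p).1 - empRisk T F (swapSamples σ p).2 =
      (1 / (m : ℝ)) * ∑ i, sgn (σ i) * (loss T F (p.1 i) - loss T F (p.2 i)) := by
  unfold empRisk
  rw [← mul_sub, ← Finset.sum_sub_distrib]
  congr 1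
  refine Finset.sum_congr rfl fun i _ => ?_
  simp only [swapSamples, sgn]
  split_ifs <;> ring

open Classical in
theorem card_swapSamples_deviation_le {C : Set (Set X)} {d : ℕ} (hd : 1 ≤ d)
    (hvc : vcDim C ≤ (d : ℕ∞)) (hm : d ≤ m) {η : ℝ} (hη : 0 ≤ η)
    (p : (Fin m → X × Bool) × (Fin m → X × Bool)) :
    ((Finset.univ.filter fun σ : Fin m → Bool => ∃ T ∈ C, ∃ F ∈ C,
      η < |empRisk T F (swapSamples σ p).1 - empRisk T F (swapSamples σ p).2|).card : ℝ) ≤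
      2 ^ m * ((2 * Real.exp 1 * m / d) ^ (2 * d) * (2 * Real.exp (-(m * η ^ 2) / 2))) := by
  have hm0 : 0 < m := by omega
  have hm' : (0 : ℝ) < m := by exact_mod_cast hm0
  let q : Fin m ⊕ Fin m → X := Sum.elim (fun i => (p.1 i).1) fun i => (p.2 i).1
  -- One representative per trace; the value `∅` off the traces is a dummy.
  have hrep : ∀ s : Finset (Fin m ⊕ Fin m), ∃ A : Set X,
      s ∈ traces C q → ∀ i, i ∈ s ↔ q i ∈ A := by
    intro s
    by_cases hs : s ∈ traces C q
    · obtain ⟨A, -, hA⟩ := mem_traces.1 hs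
      exact ⟨A, fun _ => hA⟩
    · exact ⟨∅, fun h => absurd h hs⟩
  choose A hA using hrep
  let c : Finset (Fin m ⊕ Fin m) × Finset (Fin m ⊕ Fin m) → Fin m → ℝ :=
    fun st i => loss (A st.1) (A st.2) (p.1 i) - loss (A st.1) (A st.2) (p.2 i)
  have hsub : (Finset.univ.filter fun σ : Fin m → Bool => ∃ T ∈ C, ∃ F ∈ C,
      η < |empRisk T F (swapSamples σ p).1 - empRisk T F (swapSamples σ p).2|) ⊆
      (traces C q ×ˢ traces C q).biUnion fun st =>
        Finset.univ.filter fun σ : Fin m → Bool => m * η < |∑ i, sgn (σ i) * c st i| := by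
    intro σ hσ
    obtain ⟨-, T, hT, F, hF, h⟩ := Finset.mem_filter.1 hσ
    have htr : ∀ D ∈ C, ∃ s ∈ traces C q, ∀ i, q i ∈ D ↔ q i ∈ A s := by
      intro D hD
      have hmem : (Finset.univ.filter fun i => q i ∈ D) ∈ traces C q :=
        mem_traces.2 ⟨D, hD, fun i => by simp⟩
      refine ⟨_, hmem, fun i => ?_⟩
      rw [← hA _ hmem i]
      simp
    obtain ⟨s, hs, hsT⟩ := htr T hT
    obtain ⟨t, ht, htF⟩ := htr F hF
    refine Finset.mem_biUnion.2 ⟨(s, t), Finset.mem_product.2 ⟨hs, ht⟩,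
      Finset.mem_filter.2 ⟨Finset.mem_univ _, ?_⟩⟩
    rw [empRisk_swapSamples_sub, abs_mul, abs_of_pos (by positivity), one_div,
      ← div_eq_inv_mul, lt_div_iff₀ hm', mul_comm] at h
    refine h.trans_eq ?_
    congr 1
    refine Finset.sum_congr rfl fun i _ => ?_
    have h1 : loss T F (p.1 i) = loss (A s) (A t) (p.1 i) :=
      loss_congr (hsT (Sum.inl i)) (htF (Sum.inl i))
    have h2 : loss T F (p.2 i) = loss (A s) (A t) (p.2 i) :=
      loss_congr (hsT (Sum.inr i)) (htF (Sum.inr i))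
    rw [h1, h2]
  have hcard := card_traces_le hd hvc
    (by simp only [Fintype.card_sum, Fintype.card_fin]; omega) q
  have hcast : Real.exp 1 * (Fintype.card (Fin m ⊕ Fin m) : ℝ) / d = 2 * Real.exp 1 * m / d := by
    simp only [Fintype.card_sum, Fintype.card_fin, Nat.cast_add]
    ring
  rw [hcast] at hcard
  have h1 : ((Finset.univ.filter fun σ : Fin m → Bool => ∃ T ∈ C, ∃ F ∈ C,
      η < |empRisk T F (swapSamples σ p).1 - empRisk T F (swapSamples σ p).2|).card : ℝ) ≤
      ∑ st ∈ traces C q ×ˢ traces C q, ((Finset.univ.filter fun σ : Fin m → Bool =>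
        m * η < |∑ i, sgn (σ i) * c st i|).card : ℝ) := by
    exact_mod_cast (Finset.card_le_card hsub).trans Finset.card_biUnion_le
  refine h1.trans ((Finset.sum_le_sum fun st _ => card_lt_abs_sum_sgn_le (c st)
    (fun i => abs_loss_sub_loss_le _ _ _ _) hη).trans ?_)
  rw [Finset.sum_const, nsmul_eq_mul, Finset.card_product, Nat.cast_mul]
  have h2 : ((traces C q).card : ℝ) * (traces C q).card ≤
      (2 * Real.exp 1 * m / d) ^ (2 * d) := by
    rw [two_mul d, pow_add]
    exact mul_le_mul hcard hcard (Nat.cast_nonneg _) (by positivity)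
  calc ((traces C q).card : ℝ) * (traces C q).card * (2 ^ m * (2 * Real.exp (-(m * η ^ 2) / 2)))
      ≤ (2 * Real.exp 1 * m / d) ^ (2 * d) * (2 ^ m * (2 * Real.exp (-(m * η ^ 2) / 2))) :=
        mul_le_mul_of_nonneg_right h2 (by positivity)
    _ = _ := by ring

variable [MeasurableSpace X]

/-- Symmetrization by a ghost sample; no measurability of the left-hand event is needed. -/
theorem sampleLaw_exists_le_two_mul (P : Measure X) {α : ℝ}
    [IsProbabilityMeasure (noisyMeasure P α)] {C : Set (Set X)} (hC : ∀ A ∈ C, MeasurableSet A)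
    (hm : 0 < m) {ε : ℝ} (hε : 0 ≤ ε) (hmε : 2 * Real.exp (-(m * ε ^ 2) / 2) ≤ 1 / 2) :
    sampleLaw P α m {z | ∃ T ∈ C, ∃ F ∈ C, ε < |risk P α T F - empRisk T F z|} ≤
      2 * ((sampleLaw P α m).prod (sampleLaw P α m))
        {z | ∃ T ∈ C, ∃ F ∈ C, ε / 2 < |empRisk T F z.1 - empRisk T F z.2|} := by
  have : IsProbabilityMeasure (sampleLaw P α m) := by unfold sampleLaw; infer_instance
  set μ := sampleLaw P α m
  set B := {z : (Fin m → X × Bool) × (Fin m → X × Bool) | ∃ T ∈ C, ∃ F ∈ C,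
    ε / 2 < |empRisk T F z.1 - empRisk T F z.2|}
  -- The measurable hull has the same measure and allows Fubini without measurability of `B`.
  set B' := toMeasurable (μ.prod μ) B
  have hB' : MeasurableSet B' := measurableSet_toMeasurable _ _
  have hsec : {z | ∃ T ∈ C, ∃ F ∈ C, ε < |risk P α T F - empRisk T F z|} ⊆
      {z | (2 : ENNReal)⁻¹ ≤ μ (Prod.mk z ⁻¹' B')} := by
    rintro z ⟨T, hT, F, hF, h⟩
    set D := {z' : Fin m → X × Bool | ε / 2 < |risk P α T F - empRisk T F z'|}
    have hemp : Measurable fun z' : Fin m → X × Bool => empRisk T F z' :=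
      (Finset.measurable_sum _ fun i _ =>
        (measurable_loss (hC T hT) (hC F hF)).comp (measurable_pi_apply i)).const_mul _
    have hDm : MeasurableSet D :=
      measurableSet_lt measurable_const (measurable_const.sub hemp).abs
    -- By Hoeffding at `ε / 2`, at least half of the ghost samples are `ε / 2`-accurate for the bad
    -- pair chosen from `z`.
    have hD : μ D ≤ 2⁻¹ := by
      refine (sampleLaw_deviation_le P hm (hC T hT) (hC F hF) (by linarith)).trans ?_
      have h2 : (-2 * m * (ε / 2) ^ 2 : ℝ) = -(m * ε ^ 2) / 2 := by ring
      rw [h2]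
      refine (ENNReal.ofReal_le_ofReal hmε).trans_eq ?_
      rw [one_div, ENNReal.ofReal_inv_of_pos two_pos, ENNReal.ofReal_ofNat]
    have hDc : (2 : ENNReal)⁻¹ ≤ μ Dᶜ := by
      rw [prob_compl_eq_one_sub hDm]
      calc (2 : ENNReal)⁻¹ = 1 - 2⁻¹ := ENNReal.one_sub_inv_two.symm
        _ ≤ 1 - μ D := tsub_le_tsub_left hD 1
    refine hDc.trans (measure_mono fun z' hz' => subset_toMeasurable _ _ ?_)
    refine ⟨T, hT, F, hF, ?_⟩
    have hz'' : |risk P α T F - empRisk T F z'| ≤ ε / 2 := not_lt.1 hz'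
    have htri := abs_sub_le (risk P α T F) (empRisk T F z') (empRisk T F z)
    rw [abs_sub_comm (empRisk T F z') (empRisk T F z)] at htri
    change ε / 2 < |empRisk T F z - empRisk T F z'|
    linarith
  -- Markov's inequality for the section measures, which are at least `1 / 2` on the bad event.
  have hmark := mul_meas_ge_le_lintegral (μ := μ) (measurable_measure_prodMk_left (ν := μ) hB')
    (2 : ENNReal)⁻¹
  rw [← Measure.prod_apply hB', measure_toMeasurable] at hmark
  refine (measure_mono hsec).trans ?_
  calc μ {z | (2 : ENNReal)⁻¹ ≤ μ (Prod.mk z ⁻¹' B')}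
      = 2 * (2⁻¹ * μ {z | (2 : ENNReal)⁻¹ ≤ μ (Prod.mk z ⁻¹' B')}) := by
        rw [← mul_assoc, ENNReal.mul_inv_cancel two_ne_zero ENNReal.ofNat_ne_top, one_mul]
    _ ≤ 2 * (μ.prod μ) B := by gcongr

/-- The uniform deviation bound with the squared growth function of the class. -/
theorem sampleLaw_exists_le (P : Measure X) {α : ℝ}
    [IsProbabilityMeasure (noisyMeasure P α)] {C : Set (Set X)} (hC : ∀ A ∈ C, MeasurableSet A)
    {d : ℕ} (hd : 1 ≤ d) (hvc : vcDim C ≤ (d : ℕ∞)) (hm : d ≤ m) {ε : ℝ} (hε : 0 ≤ ε)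
    (hmε : 2 * Real.exp (-(m * ε ^ 2) / 2) ≤ 1 / 2) (hW : WellBehaved C P α m) :
    sampleLaw P α m {z | ∃ T ∈ C, ∃ F ∈ C, ε < |risk P α T F - empRisk T F z|} ≤
      ENNReal.ofReal
        (4 * (2 * Real.exp 1 * m / d) ^ (2 * d) * Real.exp (-(m * ε ^ 2) / 8)) := by
  classical
  refine (sampleLaw_exists_le_two_mul P hC (by omega) hε hmε).trans ?_
  have h := measure_le_of_card_swapSamples_le (noisyMeasure P α) (hW (ε / 2))
    fun p => card_swapSamples_deviation_le hd hvc hm (by linarith) p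
  refine (mul_le_mul_right h 2).trans_eq ?_
  rw [← ENNReal.ofReal_ofNat 2, ← ENNReal.ofReal_mul (by norm_num)]
  congr 1
  have h2 : (-(m * (ε / 2) ^ 2) / 2 : ℝ) = -(m * ε ^ 2) / 8 := by ring
  rw [h2]
  ring

end Symmetrization

/-! ### Comparison of the growth factors, with `x = m / d`. -/

section Numerics

theorem one_le_growth {x : ℝ} (hx : 2 ≤ x) : 1 ≤ 0.2 * Real.exp 1 * x := by
  have := Real.exp_one_gt_d9
  nlinarith

/-- The bases differ by a factor 10, so eight spare powers of `0.2 e x` must beat 100. -/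
theorem sq_le_growth_pow {x : ℝ} (hx : 4 ≤ x) :
    (2 * Real.exp 1 * x) ^ 2 ≤ (0.2 * Real.exp 1 * x) ^ 10 := by
  have he := Real.exp_one_gt_d9
  have h1 : (2.17 : ℝ) ≤ 0.2 * Real.exp 1 * x := by nlinarith
  have h2 : (100 : ℝ) ≤ (0.2 * Real.exp 1 * x) ^ 8 :=
    le_trans (by norm_num) (pow_le_pow_left₀ (by norm_num) h1 8)
  have h3 : (2 * Real.exp 1 * x) ^ 2 = 100 * (0.2 * Real.exp 1 * x) ^ 2 := by ring
  rw [h3]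
  calc 100 * (0.2 * Real.exp 1 * x) ^ 2
      ≤ (0.2 * Real.exp 1 * x) ^ 8 * (0.2 * Real.exp 1 * x) ^ 2 :=
        mul_le_mul_of_nonneg_right h2 (sq_nonneg _)
    _ = _ := by ring

theorem exp_half_le_growth_pow {x : ℝ} (hx : 2 ≤ x) :
    Real.exp (1 / 2) ≤ (0.2 * Real.exp 1 * x) ^ 10 := by
  have he := Real.exp_one_gt_d9
  have h1 : (1.087 : ℝ) ≤ 0.2 * Real.exp 1 * x := by nlinarith
  have h2 : (2 : ℝ) ≤ (0.2 * Real.exp 1 * x) ^ 10 :=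
    le_trans (by norm_num) (pow_le_pow_left₀ (by norm_num) h1 10)
  refine le_trans ?_ h2
  have h3 : Real.exp (1 / 2) ^ 2 = Real.exp 1 := by
    rw [← Real.exp_nat_mul]
    norm_num
  have := Real.exp_one_lt_d9
  nlinarith [Real.exp_pos (1 / 2)]

/-- For sample sizes below `4 d` the bound of the theorem exceeds `1`. -/
theorem one_le_bound_of_lt {d m : ℕ} (hd : 1 ≤ d) (hm : 2 * d ≤ m) (hm4 : (m : ℝ) / d < 4)
    {ε : ℝ} (hε : 0 ≤ ε) (hε1 : ε ≤ 1) :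
    1 ≤ 4 * (0.2 * Real.exp 1 * m / d) ^ (10 * d) * Real.exp (-(m * ε ^ 2) / 8) := by
  have hd0 : (0 : ℝ) < d := by exact_mod_cast hd
  have hx : (2 : ℝ) ≤ m / d := by
    rw [le_div_iff₀ hd0]
    exact_mod_cast hm
  have h1 : Real.exp (d / 2) ≤ (0.2 * Real.exp 1 * m / d) ^ (10 * d) := by
    rw [mul_div_assoc, pow_mul]
    refine le_trans (le_of_eq ?_)
      (pow_le_pow_left₀ (Real.exp_pos _).le (exp_half_le_growth_pow hx) d)
    rw [← Real.exp_nat_mul]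
    congr 1
    ring
  -- From `m < 4 d` and `ε ≤ 1`, `m ε² / 8 ≤ d / 2`, which the growth factor absorbs.
  have h2 : Real.exp (-(d / 2)) ≤ Real.exp (-(m * ε ^ 2) / 8) := by
    apply Real.exp_le_exp.2
    rw [div_lt_iff₀ hd0] at hm4
    have : ε ^ 2 ≤ 1 := pow_le_one₀ hε hε1
    have hm0 : (0 : ℝ) ≤ m := Nat.cast_nonneg _
    nlinarith
  have h3 : Real.exp ((d : ℝ) / 2) * Real.exp (-(d / 2)) = 1 := by
    rw [← Real.exp_add, add_neg_cancel, Real.exp_zero]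
  have h4 := mul_le_mul h1 h2 (Real.exp_pos _).le (by positivity)
  rw [mul_assoc]
  linarith

end Numerics

end NoisyPAC

theorem theorem52 {X : Type*} [MeasurableSpace X]
    (C : Set (Set X)) (hC : ∀ A ∈ C, MeasurableSet A)
    (d : ℕ) (hd : 1 ≤ d) (hvc : NoisyPAC.vcDim C ≤ (d : ℕ∞))
    (P : MeasureTheory.Measure X) [MeasureTheory.IsProbabilityMeasure P]
    (α : ℝ) (hα0 : 0 ≤ α) (hα : α < 1 / 2)
    (m : ℕ) (hm : 2 * d ≤ m) (ε : ℝ) (hε : 0 < ε) :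
    (⨆ T ∈ C, ⨆ F ∈ C, NoisyPAC.sampleLaw P α m
        {z | ε < |NoisyPAC.risk P α T F - NoisyPAC.empRisk T F z|}) ≤
      ENNReal.ofReal
        (4 * (0.2 * Real.exp 1 * m / d) ^ (10 * d) * Real.exp (-(m * ε ^ 2) / 8)) ∧
    (NoisyPAC.WellBehaved C P α m →
      NoisyPAC.sampleLaw P α m
        {z | ∃ T ∈ C, ∃ F ∈ C, ε < |NoisyPAC.risk P α T F - NoisyPAC.empRisk T F z|} ≤
      ENNReal.ofReal
        (4 * (0.2 * Real.exp 1 * m / d) ^ (10 * d) * Real.exp (-(m * ε ^ 2) / 8))) := by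
  have hm1 : 0 < m := by omega
  have hd0 : (0 : ℝ) < d := by exact_mod_cast hd
  have hx : (2 : ℝ) ≤ m / d := by
    rw [le_div_iff₀ hd0]
    exact_mod_cast hm
  have hg : (1 : ℝ) ≤ (0.2 * Real.exp 1 * m / d) ^ (10 * d) := by
    rw [mul_div_assoc]
    exact one_le_pow₀ (NoisyPAC.one_le_growth hx)
  have hN := NoisyPAC.isProbabilityMeasure_noisyMeasure P hα0 (by linarith : α ≤ 1)
  constructor
  · refine iSup₂_le fun T hT => iSup₂_le fun F hF => ?_
    refine (NoisyPAC.sampleLaw_deviation_le P hm1 (hC T hT) (hC F hF) hε.le).trans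
      (ENNReal.ofReal_le_ofReal ?_)
    have hexp : Real.exp (-2 * m * ε ^ 2) ≤ Real.exp (-(m * ε ^ 2) / 8) := by
      apply Real.exp_le_exp.2
      have : 0 ≤ (m : ℝ) * ε ^ 2 := by positivity
      linarith
    have := Real.exp_pos (-(m * ε ^ 2) / 8)
    nlinarith
  · intro hW
    have hS : MeasureTheory.IsProbabilityMeasure (NoisyPAC.sampleLaw P α m) := by
      unfold NoisyPAC.sampleLaw
      infer_instance
    rcases lt_or_ge 1 ε with hε1 | hε1
    · have hempty : {z : Fin m → X × Bool | ∃ T ∈ C, ∃ F ∈ C,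
          ε < |NoisyPAC.risk P α T F - NoisyPAC.empRisk T F z|} = ∅ := by
        refine Set.eq_empty_of_forall_notMem ?_
        rintro z ⟨T, hT, F, hF, h⟩
        have h1 := NoisyPAC.risk_mem_Icc P (α := α) (hC T hT) (hC F hF)
        have h2 := NoisyPAC.empRisk_mem_Icc T F z
        have h3 : |NoisyPAC.risk P α T F - NoisyPAC.empRisk T F z| ≤ 1 :=
          abs_le.2 ⟨by linarith [h1.1, h2.2], by linarith [h1.2, h2.1]⟩
        linarith
      rw [hempty, MeasureTheory.measure_empty]
      exact zero_le
    rcases le_or_gt 1 (4 * (0.2 * Real.exp 1 * m / d) ^ (10 * d) *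
      Real.exp (-(m * ε ^ 2) / 8)) with hR | hR
    · exact MeasureTheory.prob_le_one.trans (ENNReal.one_le_ofReal.2 hR)
    have hx4 : (4 : ℝ) ≤ m / d := by
      by_contra! h
      exact absurd (NoisyPAC.one_le_bound_of_lt hd hm h hε.le hε1) (not_le.2 hR)
    -- The bound is below 1 here and its growth factor is at least 1; this yields the sample-size
    -- condition of the symmetrization.
    have he : Real.exp (-(m * ε ^ 2) / 8) ≤ 1 / 4 := by
      have := Real.exp_pos (-(m * ε ^ 2) / 8)
      nlinarith
    have hmε : 2 * Real.exp (-(m * ε ^ 2) / 2) ≤ 1 / 2 := by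
      have : Real.exp (-(m * ε ^ 2) / 2) ≤ Real.exp (-(m * ε ^ 2) / 8) := by
        apply Real.exp_le_exp.2
        have : 0 ≤ (m : ℝ) * ε ^ 2 := by positivity
        linarith
      linarith
    refine (NoisyPAC.sampleLaw_exists_le P hC hd hvc (by omega) hε.le hmε hW).trans
      (ENNReal.ofReal_le_ofReal ?_)
    have hpow : (2 * Real.exp 1 * m / d) ^ (2 * d) ≤ (0.2 * Real.exp 1 * m / d) ^ (10 * d) := by
      rw [mul_div_assoc, mul_div_assoc, pow_mul, pow_mul]
      exact pow_le_pow_left₀ (sq_nonneg _) (NoisyPAC.sq_le_growth_pow hx4) d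
    gcongr
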